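/- Let $\mathbb{S}$ be a measurable space in which singletons are measurable, and let $P=\sum_{j\ge 1}p_j\delta_{s_j}$ be a discrete probability distribution on $\mathbb{S}$, with distinct atoms $s_j$. Suppose that $P$ has regularly varying tails with index $\alpha\in(0,1)$ and slowly varying function $L$; that is, $L:[0,\infty)\to[0,\infty)$ satisfies $\lim_{t\to\infty}L(tz)/L(t)=1$ for every $z>0$, and $$\#\{j : p_j>x\}\;\sim\; x^{-\alpha}L(1/x)\qquad\text{as } x\to 0^+ .$$ Let $r\ge 1$ be an integer. For $n\ge1$ let $\mathbf{X}_n=(X_1,\dots,X_n)$ be an i.i.d. sample from $P$, let $M_{n,r}$ be the number of distinct symbols that occur exactly $r$ times in $\mathbf{X}_n$, let $$\hat\theta_r(\mathbf{X}_n)=\frac{M_{n,r}}{\binom{n}{r}},\qquad \theta_r(P;\mathbf{X}_n)=\sum_{j\ge1}p_j^{\,r}\,I\big(s_j\notin\{X_1,\dots,X_n\}\big),$$ the latter being the $r$-order missing mass, and let the relative loss be $$\ell(a,\theta)=\begin{cases}\left|\dfrac{a}{\theta}-1\right| & \text{if }\theta>0,\\[2mm] h(a) & \text{otherwise},\end{cases}$$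 where $h:\mathbb{R}\to\mathbb{R}$ is an arbitrary measurable function. Then $$\sqrt{n^{\alpha}L(n)}\;\ell\big(\hat\theta_r(\mathbf{X}_n),\theta_r(P;\mathbf{X}_n)\big)=O_P(1)\qquad\text{as } n\to\infty ;$$ that is, for every $\varepsilon>0$ there is a $K$ such that, for all sufficiently large $n$, the left-hand side exceeds $K$ in absolute value with probability at most $\varepsilon$. -/

import Mathlib

open Filter Topology MeasureTheory Asymptotics

/-- `L` is slowly varying at infinity: it maps `[0, ∞)` to `[0, ∞)` and
`L (t z) / L t → 1` as `t → ∞`, for every `z > 0`. -/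
structure IsSlowlyVarying (L : ℝ → ℝ) : Prop where
  nonneg : ∀ t, 0 ≤ t → 0 ≤ L t
  tendsto_div : ∀ z, 0 < z → Tendsto (fun t => L (t * z) / L t) atTop (𝓝 1)

/-- `tailCount P x` is the number of symbols of `P`-probability larger than `x`
(a finite number for `x > 0`). -/
noncomputable def tailCount {S : Type*} (P : PMF S) (x : ℝ) : ℕ :=
  Set.ncard {s : S | x < (P s).toReal}

/-- The discrete distribution `P` belongs to the class `Σ(α, L)`:
`tailCount P x ∼ x ^ (-α) * L (1 / x)` as `x → 0+`. -/
def HasRegularlyVaryingTails {S : Type*} (P : PMF S) (α : ℝ) (L : ℝ → ℝ) : Prop :=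
  (fun x : ℝ => (tailCount P x : ℝ)) ~[𝓝[>] 0] (fun x : ℝ => x ^ (-α) * L (1 / x))

/-- The empirical frequency of the symbol `s` in the sample `x` of size `n`. -/
noncomputable def empFreq {S : Type*} {n : ℕ} (x : Fin n → S) (s : S) : ℕ :=
  Set.ncard {i : Fin n | x i = s}

/-- `M_{n,r}`: the number of distinct symbols of frequency `r` in the sample, for `r ≥ 1`. -/
noncomputable def freqCount {S : Type*} {n : ℕ} (r : ℕ) (x : Fin n → S) : ℕ :=
  Set.ncard {s : S | empFreq x s = r}

open Classical in
/-- The `r`-order missing mass: the sum of `P(s) ^ r` over the unobserved symbols `s`. -/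
noncomputable def missingMass {S : Type*} {n : ℕ} (r : ℕ) (P : PMF S) (x : Fin n → S) : ℝ :=
  ∑' s : S, if empFreq x s = 0 then (P s).toReal ^ r else 0

/-- The Good-Turing type estimator `M_{n,r} / (n choose r)`, which uses the sample only. -/
noncomputable def goodTuring {S : Type*} {n : ℕ} (r : ℕ) (x : Fin n → S) : ℝ :=
  (freqCount r x : ℝ) / (n.choose r : ℝ)

open Classical in
/-- The relative loss of the estimate `a` of `θ`, with the value `h a` where `θ` is not positive. -/
noncomputable def relativeLoss (h : ℝ → ℝ) (a θ : ℝ) : ℝ :=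
  if 0 < θ then |a / θ - 1| else h a

/-- `Z n = O_P(1)` as `n → ∞`, where `Z n` is defined on the probability space `(Ω n, μ n)`. -/
def IsBoundedInProbability {Ω : ℕ → Type*} [∀ n, MeasurableSpace (Ω n)]
    (μ : ∀ n, Measure (Ω n)) (Z : ∀ n, Ω n → ℝ) : Prop :=
  ∀ ε : ℝ, 0 < ε → ∃ K : ℝ, ∀ᶠ n in atTop, μ n {ω | K < |Z n ω|} ≤ ENNReal.ofReal ε

/-! Write `U n = scaledCount P n`, which is equivalent to `n ^ α * L n`, and let `g` and `θ` be the
estimator and the missing mass. The claim reduces to two bounds: `E (g - θ) ^ 2 = O(U n / n ^ (2 *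
r))`, and `θ ≥ d * U n / n ^ r` with probability tending to one. Together they make the squared
relative error of order `1 / U n`.

The error bound comes from `integral_sum_symbolError_sq_le`. The error is a sum over symbols; its
diagonal second moments add up to order `cappedMass P n / n ^ (2 * r)`, and the mixed moments are
bounded by terms small enough to add up to the same order (`integral_symbolError_mul_le`). Since `α
< 1`, `cappedMass P n = O(U n)` (`exists_cappedMass_le_scaledCount`).

For the lower bound, a positive proportion of `U n` symbols have probability between `1 / (4n)` and
`1 / (2n)`, because `α > 0`. Each stays unseen with probability at least `1/2`, and Chebyshev's
inequality applies to their number (`exists_measure_missingMass_lt_le`).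

Regular variation enters these two bounds only through the limit `U (2n) / U n → 2 ^ α`, which lies
strictly between 1 and 2. -/

/-! ### Tail counts at scale `1 / n` and their doubling ratio. -/

theorem PMF.toReal_le_one {S : Type*} (P : PMF S) (s : S) : (P s).toReal ≤ 1 :=
  ENNReal.toReal_le_of_le_ofReal zero_le_one (by simpa using P.coe_le_one s)

theorem PMF.summable_toReal {S : Type*} (P : PMF S) : Summable fun s => (P s).toReal :=
  ENNReal.summable_toReal P.tsum_coe_ne_top

theorem PMF.tsum_toReal {S : Type*} (P : PMF S) : ∑' s, (P s).toReal = 1 := by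
  rw [← ENNReal.tsum_toReal_eq (fun s => P.apply_ne_top s), P.tsum_coe]
  rfl

/-- Summable terms tend to zero along the cofinite filter. Finiteness keeps `Set.ncard` away from
its default value 0 on infinite sets. -/
theorem finite_setOf_lt_toReal {S : Type*} (P : PMF S) {x : ℝ} (hx : 0 < x) :
    {s : S | x < (P s).toReal}.Finite := by
  have h := (P.summable_toReal.tendsto_cofinite_zero).eventually (gt_mem_nhds hx)
  rw [Filter.eventually_cofinite] at h
  exact h.subset fun s hs => not_lt.2 (le_of_lt hs)

theorem tailCount_anti {S : Type*} (P : PMF S) {x y : ℝ} (hx : 0 < x) (hxy : x ≤ y) :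
    tailCount P y ≤ tailCount P x :=
  Set.ncard_le_ncard (fun _ hs => hxy.trans_lt hs) (finite_setOf_lt_toReal P hx)

/-- The number of symbols of probability larger than `1 / n`. -/
noncomputable def scaledCount {S : Type*} (P : PMF S) (n : ℕ) : ℕ := tailCount P (1 / (n : ℝ))

theorem scaledCount_mono {S : Type*} (P : PMF S) {m n : ℕ} (hm : 0 < m) (hmn : m ≤ n) :
    scaledCount P m ≤ scaledCount P n := by
  have hm' : (0 : ℝ) < m := by exact_mod_cast hm
  have hmn' : (m : ℝ) ≤ n := by exact_mod_cast hmn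
  exact tailCount_anti P (one_div_pos.2 (hm'.trans_le hmn')) (one_div_le_one_div_of_le hm' hmn')

theorem scaledCount_isEquivalent {S : Type*} {P : PMF S} {α : ℝ} {L : ℝ → ℝ}
    (hP : HasRegularlyVaryingTails P α L) :
    (fun n : ℕ => (scaledCount P n : ℝ)) ~[atTop] fun n : ℕ => (n : ℝ) ^ α * L n := by
  have ht : Tendsto (fun n : ℕ => 1 / (n : ℝ)) atTop (𝓝[>] 0) := by
    refine tendsto_nhdsWithin_iff.2 ⟨tendsto_one_div_atTop_nhds_zero_nat, ?_⟩
    filter_upwards [eventually_gt_atTop 0] with n hn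
    have : (0 : ℝ) < n := by exact_mod_cast hn
    simpa using this
  refine (IsEquivalent.comp_tendsto hP ht).congr_right ?_
  filter_upwards [eventually_gt_atTop 0] with n hn
  have : (0 : ℝ) < n := by exact_mod_cast hn
  simp only [Function.comp_apply, one_div_one_div]
  rw [one_div, Real.inv_rpow this.le, Real.rpow_neg this.le, inv_inv]

theorem IsSlowlyVarying.eventually_pos {L : ℝ → ℝ} (hL : IsSlowlyVarying L) :
    ∀ᶠ t in atTop, 0 < L t := by
  have h := (hL.tendsto_div 1 one_pos).eventually (lt_mem_nhds one_half_lt_one)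
  filter_upwards [h, eventually_ge_atTop 0] with t ht ht0
  refine lt_of_le_of_ne (hL.nonneg t ht0) fun h0 => ?_
  -- With `z = 1`, a zero of `L` makes the ratio `0 / 0 = 0`, which is not near 1.
  rw [← h0, div_zero] at ht
  norm_num at ht

theorem tendsto_scaledCount_ratio {S : Type*} {P : PMF S} {α : ℝ} {L : ℝ → ℝ}
    (hL : IsSlowlyVarying L) (hP : HasRegularlyVaryingTails P α L) :
    Tendsto (fun n : ℕ => (scaledCount P (2 * n) : ℝ) / scaledCount P n) atTop (𝓝 (2 ^ α)) := by
  have h1 := scaledCount_isEquivalent hP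
  have h2 := h1.comp_tendsto (tendsto_id.const_mul_atTop' (r := 2) two_pos)
  refine (h2.div h1).symm.tendsto_nhds ?_
  have h3 := ((hL.tendsto_div 2 two_pos).comp tendsto_natCast_atTop_atTop).const_mul ((2 : ℝ) ^ α)
  rw [mul_one] at h3
  refine h3.congr' ?_
  filter_upwards [eventually_gt_atTop 0] with n hn
  have hn' : (0 : ℝ) < n := by exact_mod_cast hn
  simp only [Function.comp_apply, id, Pi.div_apply, Nat.cast_mul, Nat.cast_ofNat]
  rw [Real.mul_rpow two_pos.le hn'.le, mul_comm (n : ℝ) 2, mul_comm ((2 : ℝ) ^ α) ((n : ℝ) ^ α),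
    mul_assoc, mul_div_mul_left _ _ (Real.rpow_pos_of_pos hn' α).ne', mul_div_assoc]

theorem eventually_scaledCount_pos {S : Type*} {P : PMF S} {α : ℝ} {L : ℝ → ℝ}
    (hL : IsSlowlyVarying L) (hP : HasRegularlyVaryingTails P α L) :
    ∀ᶠ n in atTop, 0 < scaledCount P n := by
  have h0 : (0 : ℝ) < 2 ^ α := Real.rpow_pos_of_pos two_pos α
  filter_upwards [(tendsto_scaledCount_ratio hL hP).eventually (lt_mem_nhds h0)] with n hn
  -- A zero denominator would make the ratio 0, far from its positive limit.
  rcases Nat.eq_zero_or_pos (scaledCount P n) with h | h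
  · simp [h] at hn
  · exact h

theorem eventually_le_scaledCount_two_mul {S : Type*} {P : PMF S} {α : ℝ} {L : ℝ → ℝ}
    (hL : IsSlowlyVarying L) (hP : HasRegularlyVaryingTails P α L) {c : ℝ} (hc : c < 2 ^ α) :
    ∀ᶠ n in atTop, c * scaledCount P n ≤ scaledCount P (2 * n) := by
  filter_upwards [(tendsto_scaledCount_ratio hL hP).eventually (lt_mem_nhds hc),
    eventually_scaledCount_pos hL hP] with n hn hpos
  have : (0 : ℝ) < scaledCount P n := by exact_mod_cast hpos
  exact ((lt_div_iff₀ this).1 hn).le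

theorem eventually_scaledCount_two_mul_le {S : Type*} {P : PMF S} {α : ℝ} {L : ℝ → ℝ}
    (hL : IsSlowlyVarying L) (hP : HasRegularlyVaryingTails P α L) {c : ℝ} (hc : 2 ^ α < c) :
    ∀ᶠ n in atTop, (scaledCount P (2 * n) : ℝ) ≤ c * scaledCount P n := by
  filter_upwards [(tendsto_scaledCount_ratio hL hP).eventually (gt_mem_nhds hc),
    eventually_scaledCount_pos hL hP] with n hn hpos
  have : (0 : ℝ) < scaledCount P n := by exact_mod_cast hpos
  exact ((div_lt_iff₀ this).1 hn).le

theorem tendsto_scaledCount_atTop {S : Type*} {P : PMF S} {α : ℝ} {L : ℝ → ℝ} (hα : 0 < α)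
    (hL : IsSlowlyVarying L) (hP : HasRegularlyVaryingTails P α L) :
    Tendsto (scaledCount P) atTop atTop := by
  have h1 : (1 : ℝ) < 2 ^ α := Real.one_lt_rpow one_lt_two hα
  obtain ⟨c, hc1, hc2⟩ := exists_between h1
  obtain ⟨N, hN⟩ := eventually_atTop.1 ((eventually_le_scaledCount_two_mul hL hP hc2).and
    ((eventually_scaledCount_pos hL hP).and (eventually_gt_atTop 0)))
  have hN0 : 0 < N := (hN N le_rfl).2.2
  -- Each doubling strictly increases an integer, hence adds at least 1.
  have hgrow : ∀ k, k ≤ scaledCount P (2 ^ k * N) := by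
    intro k
    induction k with
    | zero => exact Nat.zero_le _
    | succ k ih =>
      obtain ⟨ha, hb, -⟩ := hN (2 ^ k * N) (Nat.le_mul_of_pos_left N (by positivity))
      have hb' : (0 : ℝ) < scaledCount P (2 ^ k * N) := by exact_mod_cast hb
      have : (scaledCount P (2 ^ k * N) : ℝ) < scaledCount P (2 * (2 ^ k * N)) := by
        refine lt_of_lt_of_le ?_ ha
        nlinarith
      have : scaledCount P (2 ^ k * N) < scaledCount P (2 * (2 ^ k * N)) := by exact_mod_cast this
      rw [pow_succ', mul_assoc]
      omega
  refine tendsto_atTop.2 fun b => ?_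
  filter_upwards [eventually_ge_atTop (2 ^ b * N)] with n hn
  exact (hgrow b).trans (scaledCount_mono P (by positivity) hn)

/-! ### The capped mass is at most a constant times the tail count. -/

/-- `∑ min 1 (n p)`, an upper bound for the mean number of distinct symbols in a sample. -/
noncomputable def cappedMass {S : Type*} (P : PMF S) (n : ℕ) : ℝ :=
  ∑' s, min 1 (n * (P s).toReal)

theorem summable_cappedMass {S : Type*} (P : PMF S) (n : ℕ) :
    Summable fun s => min 1 (n * (P s).toReal) :=
  Summable.of_nonneg_of_le (fun s => le_min zero_le_one (by positivity)) (fun s => min_le_right _ _)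
    (P.summable_toReal.mul_left _)

theorem cappedMass_nonneg {S : Type*} (P : PMF S) (n : ℕ) : 0 ≤ cappedMass P n :=
  tsum_nonneg fun s => le_min zero_le_one (by positivity)

theorem cappedMass_le {S : Type*} (P : PMF S) (n : ℕ) : cappedMass P n ≤ n := by
  calc cappedMass P n ≤ ∑' s, n * (P s).toReal :=
        (summable_cappedMass P n).tsum_le_tsum (fun s => min_le_right _ _)
          (P.summable_toReal.mul_left _)
    _ = n := by rw [tsum_mul_left, P.tsum_toReal, mul_one]

/-- A single term suffices: for the least `k` with `2 ^ (-k) < y`, either `k = 0` and the term is 2,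
or minimality gives `y ≤ 2 * 2 ^ (-k)`. In `ENNReal` the series can later be exchanged with the sum
over symbols freely. -/
theorem min_one_le_tsum_indicator {y : ℝ} (hy : 0 ≤ y) :
    ENNReal.ofReal (min 1 y) ≤
      ∑' k : ℕ, 2 * (2⁻¹ : ENNReal) ^ k * (if (1 / 2 : ℝ) ^ k < y then 1 else 0) := by
  rcases hy.eq_or_lt with rfl | hy
  · simp
  have hex : ∃ k : ℕ, (1 / 2 : ℝ) ^ k < y := exists_pow_lt_of_lt_one hy (by norm_num)
  classical
  have hk := Nat.find_spec hex
  have hmin := fun m => Nat.find_min hex (m := m)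
  set k := Nat.find hex
  refine le_trans ?_ (ENNReal.le_tsum k)
  rw [if_pos hk, mul_one]
  have e : (2 : ENNReal) * 2⁻¹ ^ k = ENNReal.ofReal (2 * (1 / 2) ^ k) := by
    rw [ENNReal.ofReal_mul (by norm_num), ENNReal.ofReal_pow (by norm_num), one_div,
      ENNReal.ofReal_inv_of_pos (by norm_num), ENNReal.ofReal_ofNat]
  rw [e]
  apply ENNReal.ofReal_le_ofReal
  rcases Nat.eq_zero_or_pos k with h0 | h0
  · rw [h0]; exact (min_le_left _ _).trans (by norm_num)
  · have := not_lt.1 (hmin (k - 1) (by omega))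
    refine (min_le_right _ _).trans (this.trans_eq ?_)
    obtain ⟨j, hj⟩ : ∃ j, k = j + 1 := ⟨k - 1, by omega⟩
    rw [hj, Nat.add_sub_cancel, pow_succ]
    ring

theorem tsum_indicator_eq_scaledCount {S : Type*} (P : PMF S) {m : ℕ} (hm : 0 < m) :
    ∑' s, (if 1 / (m : ℝ) < (P s).toReal then (1 : ENNReal) else 0) = scaledCount P m := by
  have hm' : (0 : ℝ) < m := by exact_mod_cast hm
  have hfin := finite_setOf_lt_toReal P (x := 1 / (m : ℝ)) (by positivity)
  have : ∀ s, (if 1 / (m : ℝ) < (P s).toReal then (1 : ENNReal) else 0) =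
      Set.indicator {s | 1 / (m : ℝ) < (P s).toReal} 1 s := fun s => by
    simp [Set.indicator_apply]
  simp only [this]
  rw [← tsum_subtype, Pi.one_def, ENNReal.tsum_set_one, scaledCount, tailCount,
    ← hfin.cast_ncard_eq]
  rfl

theorem cappedMass_le_tsum {S : Type*} (P : PMF S) {n : ℕ} (hn : 0 < n) :
    ENNReal.ofReal (cappedMass P n) ≤
      ∑' k : ℕ, 2 * (2⁻¹ : ENNReal) ^ k * (scaledCount P (2 ^ k * n) : ENNReal) := by
  have hn' : (0 : ℝ) < n := by exact_mod_cast hn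
  rw [cappedMass, ENNReal.ofReal_tsum_of_nonneg (fun s => le_min zero_le_one (by positivity))
    (summable_cappedMass P n)]
  refine (ENNReal.tsum_le_tsum fun s => min_one_le_tsum_indicator (by positivity)).trans ?_
  rw [ENNReal.tsum_comm]
  refine ENNReal.tsum_le_tsum fun k => ?_
  rw [ENNReal.tsum_mul_left, ← tsum_indicator_eq_scaledCount P (by positivity)]
  refine le_of_eq ?_
  congr 1
  refine tsum_congr fun s => ?_
  refine if_congr ?_ rfl rfl
  push_cast
  rw [one_div_pow, div_lt_iff₀ (by positivity), div_lt_iff₀ (by positivity)]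
  constructor <;> intro h <;> linarith

/-- For `2 ^ α < b < 2`, iterated doubling gives `U (2 ^ k * n) ≤ b ^ k * U n`, so the dyadic series
is dominated by a geometric one of ratio `b / 2 < 1`. This is where `α < 1` matters. -/
theorem exists_cappedMass_le_scaledCount {S : Type*} {P : PMF S} {α : ℝ} {L : ℝ → ℝ} (hα : α < 1)
    (hL : IsSlowlyVarying L) (hP : HasRegularlyVaryingTails P α L) :
    ∃ C : ℝ, 0 < C ∧ ∀ᶠ n in atTop, cappedMass P n ≤ C * scaledCount P n := by
  have h1 : (2 : ℝ) ^ α < 2 := by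
    simpa using Real.rpow_lt_rpow_of_exponent_lt one_lt_two hα
  obtain ⟨b, hb1, hb2⟩ := exists_between h1
  have hb0 : 0 < b := (Real.rpow_pos_of_pos two_pos α).trans hb1
  obtain ⟨N, hN⟩ := eventually_atTop.1 ((eventually_scaledCount_two_mul_le hL hP hb1).and
    (eventually_gt_atTop 0))
  refine ⟨2 * (1 - b / 2)⁻¹, by
    have : 0 < 1 - b / 2 := by linarith
    positivity, ?_⟩
  filter_upwards [eventually_ge_atTop N] with n hn
  have hn0 := (hN n hn).2
  have hgrow : ∀ k, (scaledCount P (2 ^ k * n) : ℝ) ≤ b ^ k * scaledCount P n := by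
    intro k
    induction k with
    | zero => simp
    | succ k ih =>
      have ha := (hN (2 ^ k * n) (hn.trans (Nat.le_mul_of_pos_left n (by positivity)))).1
      rw [pow_succ' 2, mul_assoc]
      refine ha.trans ?_
      rw [pow_succ' b, mul_assoc]
      exact mul_le_mul_of_nonneg_left ih hb0.le
  have hsum : HasSum (fun k : ℕ => 2 * (b / 2) ^ k * (scaledCount P n : ℝ))
      (2 * (1 - b / 2)⁻¹ * scaledCount P n) :=
    ((hasSum_geometric_of_lt_one (by positivity) (by linarith)).mul_left 2).mul_right _
  have hle : ENNReal.ofReal (cappedMass P n) ≤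
      ENNReal.ofReal (2 * (1 - b / 2)⁻¹ * scaledCount P n) := by
    refine (cappedMass_le_tsum P hn0).trans ?_
    rw [← hsum.tsum_eq, ENNReal.ofReal_tsum_of_nonneg (fun k => by positivity) hsum.summable]
    refine ENNReal.tsum_le_tsum fun k => ?_
    have e : 2 * (2⁻¹ : ENNReal) ^ k * (scaledCount P (2 ^ k * n) : ENNReal) =
        ENNReal.ofReal (2 * 2⁻¹ ^ k * scaledCount P (2 ^ k * n)) := by
      rw [ENNReal.ofReal_mul (by positivity), ENNReal.ofReal_mul (by norm_num),
        ENNReal.ofReal_pow (by norm_num), ENNReal.ofReal_inv_of_pos (by norm_num),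
        ENNReal.ofReal_ofNat, ENNReal.ofReal_natCast]
    rw [e]
    apply ENNReal.ofReal_le_ofReal
    calc (2 : ℝ) * 2⁻¹ ^ k * scaledCount P (2 ^ k * n)
        ≤ 2 * 2⁻¹ ^ k * (b ^ k * scaledCount P n) :=
          mul_le_mul_of_nonneg_left (hgrow k) (by positivity)
      _ = 2 * (b / 2) ^ k * scaledCount P n := by
          rw [div_eq_mul_inv, mul_pow]; ring
  refine (ENNReal.ofReal_le_ofReal_iff ?_).1 hle
  exact hsum.nonneg fun k => by positivity

/-- Terms of binomial type are dominated by those of `cappedMass`. -/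
theorem pow_mul_one_sub_pow_le {p : ℝ} (hp0 : 0 ≤ p) (hp1 : p ≤ 1) {n k m : ℕ} (hn : 0 < n)
    (hm : 1 ≤ m) (hk : n ≤ 2 * k) :
    p ^ m * (1 - p) ^ k ≤ 2 ^ m * m.factorial / (n : ℝ) ^ m * min 1 (n * p) := by
  have hn' : (0 : ℝ) < n := by exact_mod_cast hn
  have hk' : (n : ℝ) ≤ 2 * k := by exact_mod_cast hk
  have hexp : (1 - p) ^ k ≤ Real.exp (-(n * p / 2)) := by
    calc (1 - p) ^ k ≤ Real.exp (-p) ^ k :=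
          pow_le_pow_left₀ (by linarith) (Real.one_sub_le_exp_neg p) k
      _ = Real.exp (-(k * p)) := by rw [← Real.exp_nat_mul]; ring_nf
      _ ≤ _ := Real.exp_le_exp.2 (by nlinarith)
  -- One term of the exponential series at `n * p / 2`.
  have key : ∀ j : ℕ, (n * p) ^ j * Real.exp (-(n * p / 2)) ≤ 2 ^ j * j.factorial := by
    intro j
    have h := Real.pow_div_factorial_le_exp (n * p / 2) (by positivity) j
    rw [div_le_iff₀ (by positivity), div_pow, div_le_iff₀ (by positivity)] at h
    rw [Real.exp_neg, ← div_eq_mul_inv, div_le_iff₀ (Real.exp_pos _)]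
    linarith
  have hmain : (n * p) ^ m * Real.exp (-(n * p / 2)) ≤ 2 ^ m * m.factorial * min 1 (n * p) := by
    rw [mul_min_of_nonneg _ _ (by positivity), mul_one]
    refine le_min (key m) ?_
    -- For the bound by `n * p`, one factor is split off and `key` is applied to the remaining
    -- power.
    obtain ⟨j, rfl⟩ : ∃ j, m = j + 1 := ⟨m - 1, by omega⟩
    have h1 : (2 : ℝ) ^ j * j.factorial ≤ 2 ^ (j + 1) * (j + 1).factorial := by
      have a : (j.factorial : ℝ) ≤ (j + 1).factorial := by
        exact_mod_cast Nat.factorial_le (Nat.le_succ j)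
      gcongr
      · norm_num
      · omega
    calc (n * p) ^ (j + 1) * Real.exp (-(n * p / 2))
        = ((n * p) ^ j * Real.exp (-(n * p / 2))) * (n * p) := by ring
      _ ≤ _ := mul_le_mul_of_nonneg_right ((key j).trans h1) (by positivity)
  calc p ^ m * (1 - p) ^ k ≤ p ^ m * Real.exp (-(n * p / 2)) := by gcongr
    _ = (n * p) ^ m * Real.exp (-(n * p / 2)) / (n : ℝ) ^ m := by
        rw [mul_pow]; field_simp
    _ ≤ 2 ^ m * m.factorial * min 1 (n * p) / (n : ℝ) ^ m := by gcongr
    _ = _ := by ring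

theorem sum_pow_mul_one_sub_pow_le {S : Type*} (P : PMF S) {n k m : ℕ} (hn : 0 < n)
    (hm : 1 ≤ m) (hk : n ≤ 2 * k) (A : Finset S) :
    ∑ s ∈ A, (P s).toReal ^ m * (1 - (P s).toReal) ^ k ≤
      2 ^ m * m.factorial / (n : ℝ) ^ m * cappedMass P n := by
  calc _ ≤ ∑ s ∈ A, 2 ^ m * m.factorial / (n : ℝ) ^ m * min 1 (n * (P s).toReal) :=
        Finset.sum_le_sum fun s _ => pow_mul_one_sub_pow_le ENNReal.toReal_nonneg
          (P.toReal_le_one s) hn hm hk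
    _ = 2 ^ m * m.factorial / (n : ℝ) ^ m * ∑ s ∈ A, min 1 (n * (P s).toReal) := by
        rw [Finset.mul_sum]
    _ ≤ _ := by
        refine mul_le_mul_of_nonneg_left ?_ (by positivity)
        exact (summable_cappedMass P n).sum_le_tsum A fun s _ =>
          le_min zero_le_one (by positivity)

/-! ### Joint law of the frequencies of two symbols. -/

open Classical in
/-- The number of sample points lying in `C`. -/
noncomputable def hitCount {S : Type*} {n : ℕ} (x : Fin n → S) (C : Set S) : ℕ :=
  (Finset.univ.filter fun k => x k ∈ C).card

theorem empFreq_eq_hitCount {S : Type*} {n : ℕ} (x : Fin n → S) (s : S) :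
    empFreq x s = hitCount x {s} := by
  classical
  rw [empFreq, hitCount, ← Set.ncard_coe_finset]
  congr 1
  ext k
  simp

-- Fixing the positions `A` of the hits in `C` and `B` of those in `D` cuts out a product set. These
-- boxes partition the event with given hit counts, reducing its probability to a count of pairs of
-- positions.
open Classical in
theorem mem_pi_ite_iff {S : Type*} {n : ℕ} {C D : Set S} (hCD : Disjoint C D)
    (A B : Finset (Fin n)) (hAB : Disjoint A B) (x : Fin n → S) :
    x ∈ Set.pi Set.univ (fun k => if k ∈ A then C else if k ∈ B then D else (C ∪ D)ᶜ) ↔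
      Finset.univ.filter (fun k => x k ∈ C) = A ∧
        Finset.univ.filter (fun k => x k ∈ D) = B := by
  rw [Set.disjoint_left] at hCD
  rw [Finset.disjoint_left] at hAB
  simp only [Set.mem_pi, Set.mem_univ, true_implies, Finset.ext_iff, Finset.mem_filter,
    Finset.mem_univ, true_and, ← forall_and]
  refine forall_congr' fun k => ?_
  have h1 := @hCD (x k)
  have h2 := @hAB k
  by_cases hA : k ∈ A
  · simp only [hA, if_true]; tauto
  · by_cases hB : k ∈ B
    · simp only [hA, hB, if_true, if_false]; tauto
    · simp only [hA, hB, if_false, Set.mem_compl_iff, Set.mem_union]; tauto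

theorem measure_pi_ite {S : Type*} [MeasurableSpace S] (ν : Measure S)
    [IsProbabilityMeasure ν] {n : ℕ} (C D E : Set S) (A B : Finset (Fin n))
    (hAB : Disjoint A B) [DecidableEq (Fin n)] :
    Measure.pi (fun _ : Fin n => ν)
        (Set.pi Set.univ (fun k => if k ∈ A then C else if k ∈ B then D else E)) =
      ν C ^ A.card * ν D ^ B.card * ν E ^ (n - A.card - B.card) := by
  rw [Measure.pi_pi]
  have : ∀ k, ν (if k ∈ A then C else if k ∈ B then D else E) =
      if k ∈ A then ν C else if k ∈ B then ν D else ν E := by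
    intro k; split_ifs <;> rfl
  simp only [this]
  rw [Finset.prod_ite, Finset.prod_const, Finset.prod_ite, Finset.prod_const, Finset.prod_const,
    mul_assoc]
  have e1 : (Finset.univ.filter fun k => k ∈ A) = A := by ext; simp
  have e2 : ((Finset.univ.filter fun k => k ∉ A).filter fun k => k ∈ B) = B := by
    ext k
    simpa using fun hB hA => Finset.disjoint_left.1 hAB hA hB
  have e3 : ((Finset.univ.filter fun k => k ∉ A).filter fun k => k ∉ B) = (A ∪ B)ᶜ := by
    ext k; simp
  rw [e1, e2, e3, Finset.card_compl, Finset.card_union_of_disjoint hAB, Fintype.card_fin,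
    Nat.sub_sub]

/-- The joint law of the numbers of sample points in two disjoint sets. -/
theorem measure_hitCount_eq {S : Type*} [MeasurableSpace S] (ν : Measure S)
    [IsProbabilityMeasure ν] {n : ℕ} {C D : Set S} (hC : MeasurableSet C) (hD : MeasurableSet D)
    (hCD : Disjoint C D) (a b : ℕ) :
    Measure.pi (fun _ : Fin n => ν) {x | hitCount x C = a ∧ hitCount x D = b} =
      (n.choose a * (n - a).choose b : ℕ) * (ν C ^ a * ν D ^ b * ν (C ∪ D)ᶜ ^ (n - a - b)) := by
  classical
  let I : Finset ((_ : Finset (Fin n)) × Finset (Fin n)) :=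
    (Finset.univ.powersetCard a).sigma fun A => Aᶜ.powersetCard b
  let box : ((_ : Finset (Fin n)) × Finset (Fin n)) → Set (Fin n → S) := fun σ =>
    Set.pi Set.univ (fun k => if k ∈ σ.1 then C else if k ∈ σ.2 then D else (C ∪ D)ᶜ)
  have hI : ∀ σ ∈ I, Disjoint σ.1 σ.2 ∧ σ.1.card = a ∧ σ.2.card = b := by
    intro σ hσ
    simp only [I, Finset.mem_sigma, Finset.mem_powersetCard, Finset.subset_univ, true_and] at hσ
    exact ⟨(Finset.subset_compl_iff_disjoint_left).1 hσ.2.1, hσ.1, hσ.2.2⟩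
  have hset : {x : Fin n → S | hitCount x C = a ∧ hitCount x D = b} = ⋃ σ ∈ I, box σ := by
    ext x
    simp only [Set.mem_ofPred_eq, Set.mem_iUnion, exists_prop]
    constructor
    · rintro ⟨h1, h2⟩
      have hd : Disjoint (Finset.univ.filter fun k => x k ∈ C)
          (Finset.univ.filter fun k => x k ∈ D) := by
        rw [Finset.disjoint_left]
        intro k hk hk'
        exact Set.disjoint_left.1 hCD (Finset.mem_filter.1 hk).2 (Finset.mem_filter.1 hk').2
      refine ⟨⟨Finset.univ.filter (fun k => x k ∈ C), Finset.univ.filter (fun k => x k ∈ D)⟩,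
        ?_, (mem_pi_ite_iff hCD _ _ hd x).2 ⟨rfl, rfl⟩⟩
      simp only [I, Finset.mem_sigma, Finset.mem_powersetCard, Finset.subset_univ, true_and]
      exact ⟨h1, Finset.subset_compl_iff_disjoint_left.2 hd, h2⟩
    · rintro ⟨σ, hσ, hx⟩
      obtain ⟨h0, h1, h2⟩ := hI σ hσ
      obtain ⟨h3, h4⟩ := (mem_pi_ite_iff hCD _ _ h0 x).1 hx
      exact ⟨by rw [hitCount, h3, h1], by rw [hitCount, h4, h2]⟩
  rw [hset, measure_biUnion_finset]
  · rw [Finset.sum_congr rfl (g := fun _ => ν C ^ a * ν D ^ b * ν (C ∪ D)ᶜ ^ (n - a - b))]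
    · rw [Finset.sum_const, nsmul_eq_mul]
      congr 2
      rw [Finset.card_sigma, Finset.sum_congr rfl (g := fun _ => (n - a).choose b)]
      · simp
      · intro A hA
        rw [Finset.card_powersetCard, Finset.card_compl, (Finset.mem_powersetCard.1 hA).2,
          Fintype.card_fin]
    · intro σ hσ
      obtain ⟨h0, h1, h2⟩ := hI σ hσ
      rw [measure_pi_ite ν C D _ σ.1 σ.2 h0, h1, h2]
  · intro σ hσ τ hτ hne
    rw [Function.onFun, Set.disjoint_left]
    intro x hx hx'
    apply hne
    obtain ⟨h1, h2⟩ := (mem_pi_ite_iff hCD _ _ (hI σ hσ).1 x).1 hx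
    obtain ⟨h3, h4⟩ := (mem_pi_ite_iff hCD _ _ (hI τ hτ).1 x).1 hx'
    obtain ⟨A, B⟩ := σ
    obtain ⟨A', B'⟩ := τ
    simp only at h1 h2 h3 h4
    rw [← h1, ← h2, ← h3, ← h4]
  · intro σ _
    refine MeasurableSet.univ_pi fun k => ?_
    split_ifs
    exacts [hC, hD, (hC.union hD).compl]

theorem PMF.toMeasure_real_singleton {S : Type*} [MeasurableSpace S] [MeasurableSingletonClass S]
    (P : PMF S) (s : S) : P.toMeasure.real {s} = (P s).toReal := by
  rw [measureReal_def, P.toMeasure_apply_singleton s (measurableSet_singleton s)]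

/-- The joint law of the frequencies of two distinct symbols. -/
theorem measureReal_empFreq_pair {S : Type*} [MeasurableSpace S] [MeasurableSingletonClass S]
    (P : PMF S) {n : ℕ} {s t : S} (hst : s ≠ t) (a b : ℕ) :
    (Measure.pi (fun _ : Fin n => P.toMeasure)).real {x | empFreq x s = a ∧ empFreq x t = b} =
      n.choose a * (n - a).choose b * ((P s).toReal ^ a * (P t).toReal ^ b *
        (1 - (P s).toReal - (P t).toReal) ^ (n - a - b)) := by
  have hd : Disjoint ({s} : Set S) {t} := by simpa using hst
  have hu : P.toMeasure.real ({s} ∪ {t})ᶜ = 1 - (P s).toReal - (P t).toReal := by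
    rw [probReal_compl_eq_one_sub ((measurableSet_singleton s).union (measurableSet_singleton t)),
      measureReal_union hd (measurableSet_singleton t), PMF.toMeasure_real_singleton,
      PMF.toMeasure_real_singleton]
    ring
  simp only [empFreq_eq_hitCount]
  rw [measureReal_def, measure_hitCount_eq P.toMeasure (measurableSet_singleton s)
    (measurableSet_singleton t) hd]
  simp only [ENNReal.toReal_mul, ENNReal.toReal_pow, ← measureReal_def, hu,
    PMF.toMeasure_real_singleton, ENNReal.toReal_natCast]
  push_cast
  ring

/-- The frequency of a symbol is binomial. -/
theorem measureReal_empFreq {S : Type*} [MeasurableSpace S] [MeasurableSingletonClass S]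
    (P : PMF S) {n : ℕ} (s : S) (a : ℕ) :
    (Measure.pi (fun _ : Fin n => P.toMeasure)).real {x | empFreq x s = a} =
      n.choose a * ((P s).toReal ^ a * (1 - (P s).toReal) ^ (n - a)) := by
  -- The binomial law is the joint law with an empty second set.
  have h0 : {x : Fin n → S | empFreq x s = a} =
      {x | hitCount x {s} = a ∧ hitCount x (∅ : Set S) = 0} := by
    ext x
    simp [empFreq_eq_hitCount, hitCount]
  rw [h0, measureReal_def, measure_hitCount_eq P.toMeasure (measurableSet_singleton s)
    MeasurableSet.empty (by simp)]
  simp only [ENNReal.toReal_mul, ENNReal.toReal_pow, ← measureReal_def, Set.union_empty,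
    PMF.toMeasure_real_singleton, ENNReal.toReal_natCast,
    probReal_compl_eq_one_sub (measurableSet_singleton s)]
  simp

theorem measurableSet_empFreq_eq {S : Type*} [MeasurableSpace S] [MeasurableSingletonClass S]
    {n : ℕ} (s : S) (a : ℕ) : MeasurableSet {x : Fin n → S | empFreq x s = a} := by
  classical
  have : Measurable fun x : Fin n → S => empFreq x s := by
    have : (fun x : Fin n → S => empFreq x s) =
        fun x => ∑ k : Fin n, Set.indicator {x : Fin n → S | x k = s} (fun _ => 1) x := by
      ext x
      rw [empFreq_eq_hitCount, hitCount, Finset.card_filter]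
      simp [Set.indicator_apply]
    rw [this]
    refine Finset.measurable_sum _ fun k _ => measurable_const.indicator ?_
    have hk : Measurable fun x : Fin n → S => x k := measurable_pi_apply k
    exact hk (measurableSet_singleton s)
  exact this (measurableSet_singleton a)

/-- The indicator of the event that `s` has frequency `a` in the sample. -/
noncomputable def freqIndicator {S : Type*} {n : ℕ} (s : S) (a : ℕ) (x : Fin n → S) : ℝ :=
  Set.indicator {x : Fin n → S | empFreq x s = a} 1 x

theorem freqIndicator_eq_ite {S : Type*} {n : ℕ} (s : S) (a : ℕ) (x : Fin n → S) :
    freqIndicator s a x = if empFreq x s = a then 1 else 0 := by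
  simp [freqIndicator, Set.indicator_apply]

theorem measurable_freqIndicator {S : Type*} [MeasurableSpace S] [MeasurableSingletonClass S]
    {n : ℕ} (s : S) (a : ℕ) :
    Measurable (freqIndicator s a : (Fin n → S) → ℝ) :=
  measurable_one.indicator (measurableSet_empFreq_eq s a)

theorem integrable_of_measurable_bounded {Ω : Type*} [MeasurableSpace Ω] {μ : Measure Ω}
    [IsFiniteMeasure μ] {f : Ω → ℝ} (hf : Measurable f) {C : ℝ} (hC : ∀ x, |f x| ≤ C) :
    Integrable f μ :=
  Integrable.of_bound hf.aestronglyMeasurable C (Eventually.of_forall hC)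

theorem abs_freqIndicator_le_one {S : Type*} {n : ℕ} (s : S) (a : ℕ) (x : Fin n → S) :
    |freqIndicator s a x| ≤ 1 := by
  rw [freqIndicator_eq_ite]; split_ifs <;> simp

theorem integrable_freqIndicator {S : Type*} [MeasurableSpace S] [MeasurableSingletonClass S]
    (P : PMF S) {n : ℕ} (s : S) (a : ℕ) :
    Integrable (freqIndicator s a) (Measure.pi (fun _ : Fin n => P.toMeasure)) :=
  integrable_of_measurable_bounded (measurable_freqIndicator s a) (abs_freqIndicator_le_one s a)

theorem integrable_freqIndicator_mul {S : Type*} [MeasurableSpace S] [MeasurableSingletonClass S]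
    (P : PMF S) {n : ℕ} (s t : S) (a b : ℕ) :
    Integrable (fun x => freqIndicator s a x * freqIndicator t b x)
      (Measure.pi (fun _ : Fin n => P.toMeasure)) := by
  refine integrable_of_measurable_bounded
    ((measurable_freqIndicator s a).mul (measurable_freqIndicator t b)) (C := 1) fun x => ?_
  rw [abs_mul]
  exact mul_le_one₀ (abs_freqIndicator_le_one s a x) (abs_nonneg _)
    (abs_freqIndicator_le_one t b x)

theorem integral_freqIndicator {S : Type*} [MeasurableSpace S] [MeasurableSingletonClass S]
    (P : PMF S) {n : ℕ} (s : S) (a : ℕ) :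
    ∫ x, freqIndicator s a x ∂(Measure.pi (fun _ : Fin n => P.toMeasure)) =
      n.choose a * ((P s).toReal ^ a * (1 - (P s).toReal) ^ (n - a)) := by
  rw [← measureReal_empFreq]
  exact integral_indicator_one (measurableSet_empFreq_eq s a)

theorem integral_freqIndicator_mul {S : Type*} [MeasurableSpace S] [MeasurableSingletonClass S]
    (P : PMF S) {n : ℕ} {s t : S} (hst : s ≠ t) (a b : ℕ) :
    ∫ x, freqIndicator s a x * freqIndicator t b x
        ∂(Measure.pi (fun _ : Fin n => P.toMeasure)) =
      n.choose a * (n - a).choose b * ((P s).toReal ^ a * (P t).toReal ^ b *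
        (1 - (P s).toReal - (P t).toReal) ^ (n - a - b)) := by
  rw [← measureReal_empFreq_pair P hst]
  have hmeas : MeasurableSet {x : Fin n → S | empFreq x s = a ∧ empFreq x t = b} :=
    (measurableSet_empFreq_eq s a).inter (measurableSet_empFreq_eq t b)
  rw [← integral_indicator_one hmeas]
  refine integral_congr_ae (Eventually.of_forall fun x => ?_)
  simp only [freqIndicator_eq_ite, Set.indicator_apply, Set.mem_ofPred_eq, ite_and, Pi.one_apply]
  split_ifs <;> simp

theorem PMF.toReal_add_toReal_le_one {S : Type*} (P : PMF S) {s t : S} (hst : s ≠ t) :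
    (P s).toReal + (P t).toReal ≤ 1 := by
  classical
  rw [← P.tsum_toReal, ← Finset.sum_pair (f := fun s => (P s).toReal) hst]
  exact P.summable_toReal.sum_le_tsum {s, t} fun _ _ => ENNReal.toReal_nonneg

/-! ### Second moments of the error over finite sets of symbols. -/

/-- The contribution of the symbol `s` to the error of the Good-Turing estimator. -/
noncomputable def symbolError {S : Type*}
    (P : PMF S) {n : ℕ} (r : ℕ) (s : S) (x : Fin n → S) : ℝ :=
  (n.choose r : ℝ)⁻¹ * freqIndicator s r x - (P s).toReal ^ r * freqIndicator s 0 x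

theorem measurable_symbolError {S : Type*} [MeasurableSpace S] [MeasurableSingletonClass S]
    (P : PMF S) {n : ℕ} (r : ℕ) (s : S) :
    Measurable (symbolError P r s : (Fin n → S) → ℝ) :=
  ((measurable_freqIndicator s r).const_mul _).sub ((measurable_freqIndicator s 0).const_mul _)

theorem symbolError_mul {S : Type*} (P : PMF S) {n : ℕ} (r : ℕ) (s t : S) (x : Fin n → S) :
    symbolError P r s x * symbolError P r t x =
      (n.choose r : ℝ)⁻¹ ^ 2 * (freqIndicator s r x * freqIndicator t r x)
      - (n.choose r : ℝ)⁻¹ * (P t).toReal ^ r * (freqIndicator s r x * freqIndicator t 0 x)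
      - (n.choose r : ℝ)⁻¹ * (P s).toReal ^ r * (freqIndicator s 0 x * freqIndicator t r x)
      + (P s).toReal ^ r * (P t).toReal ^ r * (freqIndicator s 0 x * freqIndicator t 0 x) := by
  simp only [symbolError]; ring

theorem integrable_symbolError_mul {S : Type*} [MeasurableSpace S] [MeasurableSingletonClass S]
    (P : PMF S) {n : ℕ} (r : ℕ) (s t : S) :
    Integrable (fun x => symbolError P r s x * symbolError P r t x)
      (Measure.pi (fun _ : Fin n => P.toMeasure)) := by
  simp only [symbolError_mul]
  exact ((((integrable_freqIndicator_mul P s t r r).const_mul _).sub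
    ((integrable_freqIndicator_mul P s t r 0).const_mul _)).sub
    ((integrable_freqIndicator_mul P s t 0 r).const_mul _)).add
    ((integrable_freqIndicator_mul P s t 0 0).const_mul _)

theorem integral_symbolError_mul {S : Type*} [MeasurableSpace S] [MeasurableSingletonClass S]
    (P : PMF S) {n : ℕ} (r : ℕ) (s t : S) :
    ∫ x, symbolError P r s x * symbolError P r t x
        ∂(Measure.pi (fun _ : Fin n => P.toMeasure)) =
      (n.choose r : ℝ)⁻¹ ^ 2 * (∫ x, freqIndicator s r x * freqIndicator t r x
        ∂(Measure.pi (fun _ : Fin n => P.toMeasure)))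
      - (n.choose r : ℝ)⁻¹ * (P t).toReal ^ r * (∫ x, freqIndicator s r x * freqIndicator t 0 x
        ∂(Measure.pi (fun _ : Fin n => P.toMeasure)))
      - (n.choose r : ℝ)⁻¹ * (P s).toReal ^ r * (∫ x, freqIndicator s 0 x * freqIndicator t r x
        ∂(Measure.pi (fun _ : Fin n => P.toMeasure)))
      + (P s).toReal ^ r * (P t).toReal ^ r * (∫ x, freqIndicator s 0 x * freqIndicator t 0 x
        ∂(Measure.pi (fun _ : Fin n => P.toMeasure))) := by
  simp only [symbolError_mul]
  have h1 := (integrable_freqIndicator_mul P (n := n) s t r r).const_mul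
    ((n.choose r : ℝ)⁻¹ ^ 2)
  have h2 := (integrable_freqIndicator_mul P (n := n) s t r 0).const_mul
    ((n.choose r : ℝ)⁻¹ * (P t).toReal ^ r)
  have h3 := (integrable_freqIndicator_mul P (n := n) s t 0 r).const_mul
    ((n.choose r : ℝ)⁻¹ * (P s).toReal ^ r)
  have h4 := (integrable_freqIndicator_mul P (n := n) s t 0 0).const_mul
    ((P s).toReal ^ r * (P t).toReal ^ r)
  refine (integral_add ((h1.sub h2).sub h3) h4).trans ?_
  refine congrArg₂ HAdd.hAdd ((integral_sub (h1.sub h2) h3).trans ?_) (integral_const_mul _ _)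
  refine congrArg₂ HSub.hSub ((integral_sub h1 h2).trans ?_) (integral_const_mul _ _)
  exact congrArg₂ HSub.hSub (integral_const_mul _ _) (integral_const_mul _ _)

/-- With `q = 1 - p - p'`, the mixed moment is `p ^ r * p' ^ r * q ^ (n - 2 * r)` times `M / N - 2 *
q ^ r + q ^ (2 * r)`. As `M ≤ N`, that factor is at most `(1 - q ^ r) ^ 2`, and Bernoulli's
inequality makes this `O((p + p') ^ 2)`. The two extra powers of probability are the gain over a
trivial bound; `q ≤ (1 - p) * (1 - p')` separates the symbols so that the double sum factors. -/
theorem integral_symbolError_mul_le {S : Type*} [MeasurableSpace S] [MeasurableSingletonClass S]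
    (P : PMF S) {n r : ℕ} (hn : 2 * r ≤ n) {s t : S}
    (hst : s ≠ t) :
    ∫ x, symbolError P r s x * symbolError P r t x
        ∂(Measure.pi (fun _ : Fin n => P.toMeasure)) ≤
      2 * r ^ 2 *
        (((P s).toReal ^ (r + 2) * (1 - (P s).toReal) ^ (n - 2 * r)) *
            ((P t).toReal ^ r * (1 - (P t).toReal) ^ (n - 2 * r)) +
          ((P s).toReal ^ r * (1 - (P s).toReal) ^ (n - 2 * r)) *
            ((P t).toReal ^ (r + 2) * (1 - (P t).toReal) ^ (n - 2 * r))) := by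
  rw [integral_symbolError_mul, integral_freqIndicator_mul P hst, integral_freqIndicator_mul P hst,
    integral_freqIndicator_mul P hst, integral_freqIndicator_mul P hst]
  have hp0 : 0 ≤ (P s).toReal := ENNReal.toReal_nonneg
  have hp0' : 0 ≤ (P t).toReal := ENNReal.toReal_nonneg
  have hsum := P.toReal_add_toReal_le_one hst
  generalize (P s).toReal = p at *
  generalize (P t).toReal = p' at *
  obtain ⟨k, rfl⟩ := Nat.exists_eq_add_of_le hn
  have e1 : 2 * r + k - r - r = k := by omega
  have e2 : 2 * r + k - r - 0 = r + k := by omega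
  have e3 : 2 * r + k - 0 - r = r + k := by omega
  have e4 : 2 * r + k - 0 - 0 = r + r + k := by omega
  have e5 : 2 * r + k - 2 * r = k := by omega
  rw [e1, e2, e3, e4, e5]
  simp only [Nat.choose_zero_right, Nat.sub_zero, Nat.cast_one, pow_zero, mul_one, one_mul]
  have hN : (0 : ℝ) < (2 * r + k).choose r := by
    exact_mod_cast Nat.choose_pos (by omega)
  have hM : ((2 * r + k - r).choose r : ℝ) ≤ (2 * r + k).choose r := by
    exact_mod_cast Nat.choose_le_choose r (by omega)
  generalize ((2 * r + k).choose r : ℝ) = N at *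
  generalize ((2 * r + k - r).choose r : ℝ) = M at *
  set q := 1 - p - p' with hq
  have hq0 : 0 ≤ q := by linarith
  have hq1 : q ≤ (1 - p) * (1 - p') := by nlinarith
  have hr : 1 - q ^ r ≤ r * (p + p') := by
    have := one_add_mul_le_pow (a := -(p + p')) (by linarith) r
    have e : 1 + -(p + p') = q := by rw [hq]; ring
    rw [e] at this
    linarith
  have hr0 : 0 ≤ 1 - q ^ r := by
    have := pow_le_one₀ hq0 (by linarith : q ≤ 1) (n := r)
    linarith
  have hsq : (1 - q ^ r) ^ 2 ≤ 2 * r ^ 2 * (p ^ 2 + p' ^ 2) := by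
    calc (1 - q ^ r) ^ 2 ≤ (r * (p + p')) ^ 2 := pow_le_pow_left₀ hr0 hr 2
      _ ≤ _ := by nlinarith [mul_nonneg (sq_nonneg (r : ℝ)) (sq_nonneg (p - p'))]
  have hfrac : M / N ≤ 1 := (div_le_one hN).2 hM
  calc _ = p ^ r * p' ^ r * q ^ k * (M / N - 2 * q ^ r + (q ^ r) ^ 2) := by
        rw [pow_add q (r + r) k, pow_add q r r, pow_add q r k]
        field_simp
        ring
    _ ≤ p ^ r * p' ^ r * q ^ k * (2 * r ^ 2 * (p ^ 2 + p' ^ 2)) := by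
        refine mul_le_mul_of_nonneg_left ?_ (by positivity)
        nlinarith
    _ ≤ p ^ r * p' ^ r * ((1 - p) * (1 - p')) ^ k * (2 * r ^ 2 * (p ^ 2 + p' ^ 2)) := by
        gcongr
    _ = _ := by rw [mul_pow]; ring

theorem integral_symbolError_sq {S : Type*} [MeasurableSpace S] [MeasurableSingletonClass S]
    (P : PMF S) {n r : ℕ} (hr : 1 ≤ r) (hn : r ≤ n) (s : S) :
    ∫ x, symbolError P r s x * symbolError P r s x
        ∂(Measure.pi (fun _ : Fin n => P.toMeasure)) =
      (n.choose r : ℝ)⁻¹ * ((P s).toReal ^ r * (1 - (P s).toReal) ^ (n - r)) +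
        (P s).toReal ^ (2 * r) * (1 - (P s).toReal) ^ n := by
  have h : ∀ x : Fin n → S, symbolError P r s x * symbolError P r s x =
      (n.choose r : ℝ)⁻¹ ^ 2 * freqIndicator s r x +
        (P s).toReal ^ (2 * r) * freqIndicator s 0 x := by
    intro x
    simp only [symbolError, freqIndicator_eq_ite]
    -- As `r ≥ 1`, the frequencies `r` and 0 exclude each other and the cross term vanishes.
    by_cases h1 : empFreq x s = r
    · have h2 : empFreq x s ≠ 0 := by omega
      rw [if_pos h1, if_neg h2]; ring
    · rw [if_neg h1]
      split_ifs <;> ring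
  have hN : (n.choose r : ℝ) ≠ 0 := by exact_mod_cast (Nat.choose_pos hn).ne'
  simp only [h]
  rw [integral_add ((integrable_freqIndicator P s r).const_mul _)
    ((integrable_freqIndicator P s 0).const_mul _), integral_const_mul, integral_const_mul,
    integral_freqIndicator, integral_freqIndicator]
  simp only [Nat.choose_zero_right, Nat.cast_one, pow_zero, one_mul, Nat.sub_zero]
  field_simp

theorem pow_le_two_pow_mul_factorial_mul_choose {n r : ℕ} (hn : 2 * r ≤ n) :
    (n : ℝ) ^ r ≤ 2 ^ r * r.factorial * n.choose r := by
  have h : (n - r) ^ r ≤ r.factorial * n.choose r := by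
    rw [← Nat.descFactorial_eq_factorial_mul_choose]
    exact (Nat.pow_le_pow_left (by omega) r).trans (Nat.pow_sub_le_descFactorial n r)
  have h2 : n ^ r ≤ (2 * (n - r)) ^ r := Nat.pow_le_pow_left (by omega) r
  rw [mul_pow] at h2
  have := h2.trans (Nat.mul_le_mul_left _ h)
  rw [← mul_assoc] at this
  exact_mod_cast this

/-- The constant in the bound for the mean square error of the Good-Turing estimator. -/
noncomputable def errorConst (r : ℕ) : ℝ :=
  2 ^ r * r.factorial * (2 ^ r * r.factorial) + 2 ^ (2 * r) * (2 * r).factorial +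
    4 * r ^ 2 * ((2 ^ (r + 2) * (r + 2).factorial) * (2 ^ r * r.factorial))

theorem errorConst_pos (r : ℕ) : 0 < errorConst r := by
  unfold errorConst; positivity

theorem sum_integral_symbolError_sq_le {S : Type*}
    (P : PMF S) {n r : ℕ} (hr : 1 ≤ r) (hn : 4 * r ≤ n)
    (A : Finset S) :
    ∑ s ∈ A, ((n.choose r : ℝ)⁻¹ * ((P s).toReal ^ r * (1 - (P s).toReal) ^ (n - r)) +
        (P s).toReal ^ (2 * r) * (1 - (P s).toReal) ^ n) ≤
      (2 ^ r * r.factorial * (2 ^ r * r.factorial) + 2 ^ (2 * r) * (2 * r).factorial) *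
        (cappedMass P n / (n : ℝ) ^ (2 * r)) := by
  have hn0 : 0 < n := by omega
  have hn' : (0 : ℝ) < n := by exact_mod_cast hn0
  have hF := cappedMass_nonneg P n
  have hN : (0 : ℝ) < n.choose r := by exact_mod_cast Nat.choose_pos (by omega)
  have hinv : (n.choose r : ℝ)⁻¹ ≤ 2 ^ r * r.factorial / (n : ℝ) ^ r := by
    rw [inv_le_comm₀ hN (by positivity), inv_div, div_le_iff₀ (by positivity)]
    linarith [pow_le_two_pow_mul_factorial_mul_choose (show 2 * r ≤ n by omega)]
  rw [Finset.sum_add_distrib, ← Finset.mul_sum]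
  have h1 := sum_pow_mul_one_sub_pow_le P hn0 hr (show n ≤ 2 * (n - r) by omega) A
  have h2 := sum_pow_mul_one_sub_pow_le P hn0 (show 1 ≤ 2 * r by omega)
    (show n ≤ 2 * n by omega) A
  calc _ ≤ 2 ^ r * r.factorial / (n : ℝ) ^ r *
          (2 ^ r * r.factorial / (n : ℝ) ^ r * cappedMass P n) +
        2 ^ (2 * r) * (2 * r).factorial / (n : ℝ) ^ (2 * r) * cappedMass P n := by
        refine add_le_add (mul_le_mul hinv h1 ?_ (by positivity)) h2
        exact Finset.sum_nonneg fun s _ => mul_nonneg (by positivity)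
          (pow_nonneg (by linarith [P.toReal_le_one s]) _)
    _ = _ := by rw [two_mul r, pow_add (n : ℝ) r r]; field_simp

theorem integral_sum_symbolError_sq_le {S : Type*} [MeasurableSpace S] [MeasurableSingletonClass S]
    (P : PMF S) {n r : ℕ} (hr : 1 ≤ r) (hn : 4 * r ≤ n)
    (A : Finset S) :
    ∫ x, (∑ s ∈ A, symbolError P r s x) ^ 2 ∂(Measure.pi (fun _ : Fin n => P.toMeasure)) ≤
      errorConst r * (cappedMass P n / (n : ℝ) ^ (2 * r)) := by
  classical
  have hn0 : 0 < n := by omega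
  have hn' : (0 : ℝ) < n := by exact_mod_cast hn0
  have hF := cappedMass_nonneg P n
  let k := n - 2 * r
  let u : S → ℝ := fun s => (P s).toReal ^ (r + 2) * (1 - (P s).toReal) ^ k
  let v : S → ℝ := fun s => (P s).toReal ^ r * (1 - (P s).toReal) ^ k
  have hpow : ∀ s, 0 ≤ (1 - (P s).toReal) ^ k := fun s =>
    pow_nonneg (by linarith [P.toReal_le_one s]) _
  have hu : ∀ s, 0 ≤ u s := fun s => mul_nonneg (by positivity) (hpow s)
  have hv : ∀ s, 0 ≤ v s := fun s => mul_nonneg (by positivity) (hpow s)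
  let d : S → ℝ := fun s =>
    (n.choose r : ℝ)⁻¹ * ((P s).toReal ^ r * (1 - (P s).toReal) ^ (n - r)) +
      (P s).toReal ^ (2 * r) * (1 - (P s).toReal) ^ n
  have hterm : ∀ s t, ∫ x, symbolError P r s x * symbolError P r t x
        ∂(Measure.pi (fun _ : Fin n => P.toMeasure)) ≤
      (if s = t then d s else 0) + 2 * r ^ 2 * (u s * v t + v s * u t) := by
    intro s t
    have hnn : 0 ≤ 2 * (r : ℝ) ^ 2 * (u s * v t + v s * u t) := by
      have := mul_nonneg (hu s) (hv t)
      have := mul_nonneg (hv s) (hu t)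
      positivity
    by_cases hst : s = t
    · subst hst
      rw [if_pos rfl, integral_symbolError_sq P hr (by omega)]
      exact le_add_of_nonneg_right hnn
    · rw [if_neg hst, zero_add]
      exact integral_symbolError_mul_le P (by omega) hst
  have hU : ∑ s ∈ A, u s ≤ 2 ^ (r + 2) * (r + 2).factorial / (n : ℝ) ^ (r + 2) *
      cappedMass P n := sum_pow_mul_one_sub_pow_le P hn0 (by omega) (by omega) A
  have hV : ∑ s ∈ A, v s ≤ 2 ^ r * r.factorial / (n : ℝ) ^ r * cappedMass P n :=
    sum_pow_mul_one_sub_pow_le P hn0 hr (by omega) A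
  have hUV : (∑ s ∈ A, u s) * ∑ s ∈ A, v s ≤
      ((2 ^ (r + 2) * (r + 2).factorial) * (2 ^ r * r.factorial)) *
        (cappedMass P n / (n : ℝ) ^ (2 * r)) := by
    -- The additional `n ^ (-2)` from the two extra powers pays for one of the two factors
    -- `cappedMass P n ≤ n`.
    have hFF : cappedMass P n * cappedMass P n ≤ (n : ℝ) ^ 2 * cappedMass P n := by
      refine mul_le_mul_of_nonneg_right ?_ hF
      have h1 : (1 : ℝ) ≤ n := by exact_mod_cast hn0
      exact (cappedMass_le P n).trans (by nlinarith)
    calc _ ≤ (2 ^ (r + 2) * (r + 2).factorial / (n : ℝ) ^ (r + 2) * cappedMass P n) *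
          (2 ^ r * r.factorial / (n : ℝ) ^ r * cappedMass P n) :=
          mul_le_mul hU hV (Finset.sum_nonneg fun s _ => hv s) (by positivity)
      _ = ((2 ^ (r + 2) * (r + 2).factorial) * (2 ^ r * r.factorial)) /
          ((n : ℝ) ^ (2 * r) * (n : ℝ) ^ 2) * (cappedMass P n * cappedMass P n) := by
          rw [two_mul r, pow_add (n : ℝ) r r, pow_add (n : ℝ) r 2]; field_simp
      _ ≤ ((2 ^ (r + 2) * (r + 2).factorial) * (2 ^ r * r.factorial)) /
          ((n : ℝ) ^ (2 * r) * (n : ℝ) ^ 2) * ((n : ℝ) ^ 2 * cappedMass P n) :=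
          mul_le_mul_of_nonneg_left hFF (by positivity)
      _ = _ := by field_simp
  calc ∫ x, (∑ s ∈ A, symbolError P r s x) ^ 2 ∂(Measure.pi (fun _ : Fin n => P.toMeasure))
      = ∑ s ∈ A, ∑ t ∈ A, ∫ x, symbolError P r s x * symbolError P r t x
        ∂(Measure.pi (fun _ : Fin n => P.toMeasure)) := by
        simp only [sq, Finset.sum_mul_sum]
        rw [integral_finsetSum _ fun s _ => integrable_finsetSum _ fun t _ =>
          integrable_symbolError_mul P r s t]
        refine Finset.sum_congr rfl fun s _ => ?_
        rw [integral_finsetSum _ fun t _ => integrable_symbolError_mul P r s t]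
    _ ≤ ∑ s ∈ A, ∑ t ∈ A, ((if s = t then d s else 0) +
        2 * r ^ 2 * (u s * v t + v s * u t)) :=
        Finset.sum_le_sum fun s _ => Finset.sum_le_sum fun t _ => hterm s t
    _ = ∑ s ∈ A, d s + 4 * r ^ 2 * ((∑ s ∈ A, u s) * ∑ s ∈ A, v s) := by
        simp only [Finset.sum_add_distrib, ← Finset.mul_sum, ← Finset.sum_mul]
        rw [Finset.sum_congr rfl (g := d) fun s hs => by rw [Finset.sum_ite_eq, if_pos hs]]
        ring
    _ ≤ _ := by
        rw [errorConst, add_mul, mul_assoc (4 * (r : ℝ) ^ 2)]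
        exact add_le_add (sum_integral_symbolError_sq_le P hr hn A)
          (mul_le_mul_of_nonneg_left hUV (by positivity))

/-! ### From finite sets of symbols to the full error. -/

theorem empFreq_eq_zero_of_notMem_range {S : Type*} {n : ℕ} {x : Fin n → S} {s : S}
    (h : s ∉ Set.range x) : empFreq x s = 0 := by
  rw [empFreq, Set.ncard_eq_zero]
  ext k
  simpa using fun hk => h ⟨k, hk⟩

theorem hasSum_freqIndicator {S : Type*} {n r : ℕ} (hr : 1 ≤ r) (x : Fin n → S) :
    HasSum (fun s => freqIndicator s r x) (freqCount r x) := by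
  have hfin : {s : S | empFreq x s = r}.Finite := by
    refine (Set.finite_range x).subset fun s (hs : empFreq x s = r) => ?_
    by_contra h
    rw [empFreq_eq_zero_of_notMem_range h] at hs
    omega
  have h := hasSum_sum_of_ne_finset_zero (f := fun s => freqIndicator s r x)
    (s := hfin.toFinset) (L := .unconditional S) fun s hs => by
      rw [freqIndicator_eq_ite, if_neg (by simpa using hs)]
  have e : ∑ s ∈ hfin.toFinset, freqIndicator s r x = freqCount r x := by
    rw [Finset.sum_congr rfl (g := fun _ => (1 : ℝ)) fun s hs => by
      rw [freqIndicator_eq_ite, if_pos (by simpa using hs)]]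
    rw [Finset.sum_const, nsmul_eq_mul, mul_one, freqCount, Set.ncard_eq_toFinset_card _ hfin]
  rwa [e] at h

theorem summable_missingMass {S : Type*} (P : PMF S) {n r : ℕ} (hr : 1 ≤ r) (x : Fin n → S) :
    Summable fun s => (P s).toReal ^ r * freqIndicator s 0 x := by
  refine Summable.of_nonneg_of_le (fun s => ?_) (fun s => ?_) P.summable_toReal
  · rw [freqIndicator_eq_ite]; split_ifs <;> positivity
  · have h := pow_le_of_le_one ENNReal.toReal_nonneg (P.toReal_le_one s) (show r ≠ 0 by omega)
    rw [freqIndicator_eq_ite]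
    split_ifs
    · simpa using h
    · simp

theorem missingMass_eq_tsum {S : Type*} (P : PMF S) {n : ℕ} (r : ℕ) (x : Fin n → S) :
    missingMass r P x = ∑' s, (P s).toReal ^ r * freqIndicator s 0 x := by
  rw [missingMass]
  refine tsum_congr fun s => ?_
  rw [freqIndicator_eq_ite]
  split_ifs <;> simp

theorem hasSum_symbolError {S : Type*} (P : PMF S) {n r : ℕ} (hr : 1 ≤ r) (x : Fin n → S) :
    HasSum (fun s => symbolError P r s x) (goodTuring r x - missingMass r P x) := by
  have h1 := (hasSum_freqIndicator hr x).mul_left (n.choose r : ℝ)⁻¹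
  have h2 := (summable_missingMass P hr x).hasSum
  rw [← missingMass_eq_tsum] at h2
  have h3 := h1.sub h2
  rwa [inv_mul_eq_div] at h3

theorem ae_mem_support {S : Type*} [MeasurableSpace S] [MeasurableSingletonClass S]
    (P : PMF S) (n : ℕ) :
    ∀ᵐ x ∂(Measure.pi (fun _ : Fin n => P.toMeasure)), ∀ k, x k ∈ P.support := by
  rw [ae_all_iff]
  intro k
  have h : ∀ᵐ y ∂P.toMeasure, y ∈ P.support := by
    rw [ae_iff]
    exact (P.toMeasure_apply_eq_zero_iff
      (P.support_countable.measurableSet.compl)).2 disjoint_compl_right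
  exact (Measure.quasiMeasurePreserving_eval (fun _ : Fin n => P.toMeasure) k).ae h

/-- Almost surely only symbols of the support are sampled, and any other symbol then contributes
zero. Restricting to the countable support makes the finite subsets a countably generated filter, as
limits of measurable functions and Fatou's lemma require. -/
theorem ae_hasSum_symbolError {S : Type*} [MeasurableSpace S] [MeasurableSingletonClass S]
    (P : PMF S) {n r : ℕ} (hr : 1 ≤ r) :
    ∀ᵐ x ∂(Measure.pi (fun _ : Fin n => P.toMeasure)),
      HasSum (fun s : P.support => symbolError P r (s : S) x)
        (goodTuring r x - missingMass r P x) := by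
  filter_upwards [ae_mem_support P n] with x hx
  refine (hasSum_subtype_iff_of_support_subset (s := P.support)
    (f := fun s => symbolError P r s x) ?_).2 (hasSum_symbolError P hr x)
  intro s hs
  by_contra h
  apply hs
  have h0 : empFreq x s = 0 := empFreq_eq_zero_of_notMem_range fun ⟨k, hk⟩ => h (hk ▸ hx k)
  have hP : P s = 0 := by simpa [PMF.mem_support_iff] using h
  have hr0 : 0 ≠ r := by omega
  simp [symbolError, freqIndicator_eq_ite, h0, hP, hr0, hr0.symm]

theorem aemeasurable_goodTuring_sub_missingMass {S : Type*} [MeasurableSpace S] [MeasurableSingletonClass S]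
    (P : PMF S) {n r : ℕ} (hr : 1 ≤ r) :
    AEMeasurable (fun x : Fin n → S => goodTuring r x - missingMass r P x)
      (Measure.pi (fun _ : Fin n => P.toMeasure)) := by
  have : Countable P.support := P.support_countable.to_subtype
  exact aemeasurable_of_tendsto_metrizable_ae (atTop : Filter (Finset P.support))
    (fun A => (Finset.measurable_fun_sum A fun s _ => measurable_symbolError P r _).aemeasurable)
    (ae_hasSum_symbolError P hr)

/-- The mean square error of the Good-Turing estimator of the missing mass. -/
theorem lintegral_goodTuring_sub_missingMass_sq_le {S : Type*} [MeasurableSpace S] [MeasurableSingletonClass S]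
    (P : PMF S) {n r : ℕ} (hr : 1 ≤ r)
    (hn : 4 * r ≤ n) :
    ∫⁻ x, ENNReal.ofReal ((goodTuring r x - missingMass r P x) ^ 2)
        ∂(Measure.pi (fun _ : Fin n => P.toMeasure)) ≤
      ENNReal.ofReal (errorConst r * (cappedMass P n / (n : ℝ) ^ (2 * r))) := by
  have : Countable P.support := P.support_countable.to_subtype
  let f : Finset P.support → (Fin n → S) → ENNReal := fun A x =>
    ENNReal.ofReal ((∑ s ∈ A, symbolError P r (s : S) x) ^ 2)
  have hmeas : ∀ A, Measurable (f A) := fun A =>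
    ((Finset.measurable_fun_sum A fun s _ => measurable_symbolError P r _).pow_const
      2).ennreal_ofReal
  -- The bound on finite sums is uniform in `A`, so Fatou's lemma carries it to the limit.
  calc _ = ∫⁻ x, liminf (fun A => f A x) atTop
        ∂(Measure.pi (fun _ : Fin n => P.toMeasure)) := by
        refine lintegral_congr_ae ?_
        filter_upwards [ae_hasSum_symbolError P hr] with x hx
        exact (Tendsto.liminf_eq
          ((ENNReal.continuous_ofReal.tendsto _).comp (Tendsto.pow hx 2))).symm
    _ ≤ liminf (fun A => ∫⁻ x, f A x ∂(Measure.pi (fun _ : Fin n => P.toMeasure))) atTop :=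
        lintegral_liminf_le hmeas
    _ ≤ _ := by
        refine liminf_le_of_frequently_le' (Frequently.of_forall fun A => ?_)
        have hint : Integrable (fun x => (∑ s ∈ A, symbolError P r (s : S) x) ^ 2)
            (Measure.pi (fun _ : Fin n => P.toMeasure)) := by
          simp only [sq, Finset.sum_mul_sum]
          exact integrable_finsetSum _ fun s _ => integrable_finsetSum _ fun t _ =>
            integrable_symbolError_mul P r _ _
        rw [← ofReal_integral_eq_lintegral_ofReal hint (Eventually.of_forall fun x => sq_nonneg _)]
        apply ENNReal.ofReal_le_ofReal
        have h := integral_sum_symbolError_sq_le P hr hn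
          (A.map (Function.Embedding.subtype _))
        simpa only [Finset.sum_map, Function.Embedding.subtype_apply] using h

theorem measure_le_sq_goodTuring_sub_missingMass_le {S : Type*} [MeasurableSpace S] [MeasurableSingletonClass S]
    (P : PMF S) {n r : ℕ} (hr : 1 ≤ r) (hn : 4 * r ≤ n)
    {δ : ℝ} (hδ : 0 < δ) :
    Measure.pi (fun _ : Fin n => P.toMeasure)
        {x | δ ≤ (goodTuring r x - missingMass r P x) ^ 2} ≤
      ENNReal.ofReal (errorConst r * (cappedMass P n / (n : ℝ) ^ (2 * r)) / δ) := by
  have h := meas_ge_le_lintegral_div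
    ((aemeasurable_goodTuring_sub_missingMass P (n := n) hr).pow_const 2).ennreal_ofReal
    (ε := ENNReal.ofReal δ) (by simpa using hδ) ENNReal.ofReal_ne_top
  rw [ENNReal.ofReal_div_of_pos hδ]
  refine le_trans (measure_mono fun x hx => ?_) (h.trans (ENNReal.div_le_div_right
    (lintegral_goodTuring_sub_missingMass_sq_le P hr hn) _))
  exact ENNReal.ofReal_le_ofReal hx

/-! ### Lower bound for the missing mass. -/

/-- The mean number of unseen symbols in `A`. -/
noncomputable def meanUnseen {S : Type*} (P : PMF S) (n : ℕ) (A : Finset S) : ℝ :=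
  ∑ s ∈ A, (1 - (P s).toReal) ^ n

theorem integral_sum_freqIndicator_zero {S : Type*} [MeasurableSpace S] [MeasurableSingletonClass S]
    (P : PMF S) (n : ℕ) (A : Finset S) :
    ∫ x, ∑ s ∈ A, freqIndicator s 0 x ∂(Measure.pi (fun _ : Fin n => P.toMeasure)) =
      meanUnseen P n A := by
  rw [integral_finsetSum _ fun s _ => integrable_freqIndicator P s 0]
  simp [integral_freqIndicator, meanUnseen]

theorem integrable_sum_freqIndicator_zero_sq {S : Type*} [MeasurableSpace S] [MeasurableSingletonClass S]
    (P : PMF S) (n : ℕ) (A : Finset S) :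
    Integrable (fun x => (∑ s ∈ A, freqIndicator s 0 x) ^ 2)
      (Measure.pi (fun _ : Fin n => P.toMeasure)) := by
  simp only [sq, Finset.sum_mul_sum]
  exact integrable_finsetSum _ fun s _ => integrable_finsetSum _ fun t _ =>
    integrable_freqIndicator_mul P _ _ _ _

/-- Absences of distinct symbols are negatively correlated, since `1 - p - p' ≤ (1 - p) * (1 - p')`.
Hence the variance of the number unseen is at most its mean. -/
theorem integral_sum_freqIndicator_zero_sq_le {S : Type*} [MeasurableSpace S] [MeasurableSingletonClass S]
    (P : PMF S) (n : ℕ) (A : Finset S) :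
    ∫ x, (∑ s ∈ A, freqIndicator s 0 x) ^ 2 ∂(Measure.pi (fun _ : Fin n => P.toMeasure)) ≤
      meanUnseen P n A + meanUnseen P n A ^ 2 := by
  classical
  let w : S → ℝ := fun s => (1 - (P s).toReal) ^ n
  have hw : ∀ s, 0 ≤ w s := fun s => pow_nonneg (by linarith [P.toReal_le_one s]) n
  have hterm : ∀ s t, ∫ x, freqIndicator s 0 x * freqIndicator t 0 x
        ∂(Measure.pi (fun _ : Fin n => P.toMeasure)) ≤ (if s = t then w s else 0) + w s * w t := by
    intro s t
    by_cases hst : s = t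
    · subst hst
      have e : ∀ x : Fin n → S, freqIndicator s 0 x * freqIndicator s 0 x =
          freqIndicator s 0 x := fun x => by
        rw [freqIndicator_eq_ite]; split_ifs <;> simp
      simp only [e, integral_freqIndicator, if_true, Nat.choose_zero_right, Nat.cast_one, pow_zero,
        one_mul, Nat.sub_zero]
      exact le_add_of_nonneg_right (mul_nonneg (hw s) (hw s))
    · rw [if_neg hst, zero_add, integral_freqIndicator_mul P hst]
      simp only [Nat.choose_zero_right, Nat.cast_one, pow_zero, one_mul, Nat.sub_zero, w]
      rw [← mul_pow]
      refine pow_le_pow_left₀ (by linarith [P.toReal_add_toReal_le_one hst]) ?_ n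
      have : 0 ≤ (P s).toReal * (P t).toReal := by positivity
      linarith
  calc _ = ∑ s ∈ A, ∑ t ∈ A, ∫ x, freqIndicator s 0 x * freqIndicator t 0 x
        ∂(Measure.pi (fun _ : Fin n => P.toMeasure)) := by
        simp only [sq, Finset.sum_mul_sum]
        rw [integral_finsetSum _ fun s _ => integrable_finsetSum _ fun t _ =>
          integrable_freqIndicator_mul P s t 0 0]
        refine Finset.sum_congr rfl fun s _ => ?_
        rw [integral_finsetSum _ fun t _ => integrable_freqIndicator_mul P s t 0 0]
    _ ≤ ∑ s ∈ A, ∑ t ∈ A, ((if s = t then w s else 0) + w s * w t) :=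
        Finset.sum_le_sum fun s _ => Finset.sum_le_sum fun t _ => hterm s t
    _ = _ := by
        simp only [Finset.sum_add_distrib, ← Finset.mul_sum, ← Finset.sum_mul]
        rw [Finset.sum_congr rfl (g := w) fun s hs => by rw [Finset.sum_ite_eq, if_pos hs]]
        rw [meanUnseen, sq]

/-- Chebyshev's inequality for a deviation of half the mean `m`, with variance at most `m`. -/
theorem measure_unseen_le {S : Type*} [MeasurableSpace S] [MeasurableSingletonClass S]
    (P : PMF S) (n : ℕ) (A : Finset S) (hm : 0 < meanUnseen P n A) :
    Measure.pi (fun _ : Fin n => P.toMeasure)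
        {x | ∑ s ∈ A, freqIndicator s 0 x ≤ meanUnseen P n A / 2} ≤
      ENNReal.ofReal (4 / meanUnseen P n A) := by
  set m := meanUnseen P n A with hmdef
  have h1 : Integrable (fun x => ∑ s ∈ A, freqIndicator s 0 x)
      (Measure.pi (fun _ : Fin n => P.toMeasure)) :=
    integrable_finsetSum _ fun s _ => integrable_freqIndicator P s 0
  have h2 := integrable_sum_freqIndicator_zero_sq P n A
  have hexp : ∀ x : Fin n → S, (∑ s ∈ A, freqIndicator s 0 x - m) ^ 2 =
      (∑ s ∈ A, freqIndicator s 0 x) ^ 2 - 2 * m * (∑ s ∈ A, freqIndicator s 0 x) + m ^ 2 :=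
    fun x => by ring
  have hint : Integrable (fun x => (∑ s ∈ A, freqIndicator s 0 x - m) ^ 2)
      (Measure.pi (fun _ : Fin n => P.toMeasure)) := by
    simp only [hexp]
    exact (h2.sub (h1.const_mul _)).add (integrable_const _)
  have hvar : ∫ x, (∑ s ∈ A, freqIndicator s 0 x - m) ^ 2
      ∂(Measure.pi (fun _ : Fin n => P.toMeasure)) ≤ m := by
    simp only [hexp]
    rw [integral_add (by exact h2.sub (h1.const_mul (2 * m))) (integrable_const _),
      integral_sub h2 (h1.const_mul _), integral_const_mul, integral_sum_freqIndicator_zero]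
    have := integral_sum_freqIndicator_zero_sq_le P n A
    rw [← hmdef] at this ⊢
    simp only [integral_const, probReal_univ, one_smul]
    linarith
  have hmk := mul_meas_ge_le_integral_of_nonneg (Eventually.of_forall fun x => sq_nonneg _)
    hint (m ^ 2 / 4)
  have hreal : (Measure.pi (fun _ : Fin n => P.toMeasure)).real
      {x | m ^ 2 / 4 ≤ (∑ s ∈ A, freqIndicator s 0 x - m) ^ 2} ≤ 4 / m := by
    rw [le_div_iff₀ hm]
    have := hmk.trans hvar
    by_contra! hlt
    nlinarith
  have hsub : {x : Fin n → S | ∑ s ∈ A, freqIndicator s 0 x ≤ m / 2} ⊆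
      {x | m ^ 2 / 4 ≤ (∑ s ∈ A, freqIndicator s 0 x - m) ^ 2} := by
    intro x hx
    have hx' : ∑ s ∈ A, freqIndicator s 0 x ≤ m / 2 := hx
    show m ^ 2 / 4 ≤ _
    nlinarith
  refine (measure_mono hsub).trans ?_
  rw [← ofReal_measureReal]
  exact ENNReal.ofReal_le_ofReal hreal

theorem sum_unseen_le_missingMass {S : Type*}
    (P : PMF S) {n r : ℕ} (hr : 1 ≤ r) (A : Finset S) {b : ℝ}
    (hb : 0 ≤ b) (hA : ∀ s ∈ A, b ≤ (P s).toReal) (x : Fin n → S) :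
    b ^ r * ∑ s ∈ A, freqIndicator s 0 x ≤ missingMass r P x := by
  have h0 : ∀ s, 0 ≤ freqIndicator s 0 x := fun s => by
    rw [freqIndicator_eq_ite]; split_ifs <;> norm_num
  rw [missingMass_eq_tsum, Finset.mul_sum]
  refine le_trans (Finset.sum_le_sum fun s hs => ?_)
    ((summable_missingMass P hr x).sum_le_tsum A fun s _ => mul_nonneg (by positivity) (h0 s))
  exact mul_le_mul_of_nonneg_right (pow_le_pow_left₀ hb (hA s hs) r) (h0 s)

/-- A finite set of symbols of probability of order `1 / n`, many of which stay unseen. -/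
theorem exists_finset_meanUnseen_ge {S : Type*} (P : PMF S) {n : ℕ} (hn : 0 < n) :
    ∃ A : Finset S, (∀ s ∈ A, 1 / (4 * n : ℝ) ≤ (P s).toReal) ∧
      ((scaledCount P (2 * (2 * n)) : ℝ) - scaledCount P (2 * n)) / 2 ≤ meanUnseen P n A := by
  have hn' : (0 : ℝ) < n := by exact_mod_cast hn
  -- The set is `g \ f`, where `1 / (4n) < p ≤ 1 / (2n)`: the upper edge gives `(1 - p) ^ n ≥ 1 - n
  -- * p ≥ 1/2` by Bernoulli.
  let f := {s : S | 1 / ((2 * n : ℕ) : ℝ) < (P s).toReal}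
  let g := {s : S | 1 / ((2 * (2 * n) : ℕ) : ℝ) < (P s).toReal}
  have hf : f.Finite := finite_setOf_lt_toReal P (by positivity)
  have hg : g.Finite := finite_setOf_lt_toReal P (by positivity)
  have hgf : (g \ f).Finite := hg.subset Set.sdiff_subset
  refine ⟨hgf.toFinset, fun s hs => ?_, ?_⟩
  · have h : 1 / ((2 * (2 * n) : ℕ) : ℝ) < (P s).toReal := ((hgf.mem_toFinset).1 hs).1
    push_cast at h
    rw [← mul_assoc] at h
    norm_num at h ⊢
    exact h.le
  · have hcard : (scaledCount P (2 * (2 * n)) : ℝ) - scaledCount P (2 * n) ≤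
        hgf.toFinset.card := by
      have h := Set.le_ncard_sdiff f g hf
      rw [Set.ncard_eq_toFinset_card _ hgf] at h
      have h' : scaledCount P (2 * (2 * n)) ≤ hgf.toFinset.card + scaledCount P (2 * n) :=
        tsub_le_iff_right.1 h
      have : (scaledCount P (2 * (2 * n)) : ℝ) ≤ hgf.toFinset.card + scaledCount P (2 * n) := by
        exact_mod_cast h'
      linarith
    have hterm : ∀ s ∈ hgf.toFinset, (1 / 2 : ℝ) ≤ (1 - (P s).toReal) ^ n := by
      intro s hs
      have h : ¬ 1 / ((2 * n : ℕ) : ℝ) < (P s).toReal := ((hgf.mem_toFinset).1 hs).2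
      rw [not_lt] at h
      push_cast at h
      have hb := one_add_mul_le_pow (a := -(P s).toReal) (by linarith [P.toReal_le_one s]) n
      rw [← sub_eq_add_neg] at hb
      refine le_trans ?_ hb
      rw [le_div_iff₀ (by positivity)] at h
      linarith
    have := Finset.card_nsmul_le_sum _ _ _ hterm
    rw [nsmul_eq_mul] at this
    rw [meanUnseen]
    linarith

/-- With high probability, the missing mass is at least of order `n ^ (-r) * scaledCount P n`. -/
theorem exists_measure_missingMass_lt_le {S : Type*} [MeasurableSpace S]
    [MeasurableSingletonClass S] {P : PMF S} {α : ℝ} {L : ℝ → ℝ} (hα : 0 < α)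
    (hL : IsSlowlyVarying L) (hP : HasRegularlyVaryingTails P α L) {r : ℕ} (hr : 1 ≤ r) :
    ∃ d : ℝ, 0 < d ∧ ∀ ε : ℝ, 0 < ε → ∀ᶠ n : ℕ in atTop,
      Measure.pi (fun _ : Fin n => P.toMeasure)
          {x | missingMass r P x < d * scaledCount P n / (n : ℝ) ^ r} ≤ ENNReal.ofReal ε := by
  have h1 : (1 : ℝ) < 2 ^ α := Real.one_lt_rpow one_lt_two hα
  obtain ⟨c, hc1, hc2⟩ := exists_between h1
  have hc0 : 0 < c - 1 := by linarith
  -- Each chosen symbol has probability at least `1 / (4n)`, whence `(1 / 4) ^ r`. Their mean unseen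
  -- number is at least `(c - 1) / 2 * U n`, and half of it survives Chebyshev.
  refine ⟨(1 / 4) ^ r * ((c - 1) / 4), by positivity, fun ε hε => ?_⟩
  have hdouble : Tendsto (fun n : ℕ => 2 * n) atTop atTop :=
    tendsto_id.const_mul_atTop' two_pos
  have hU := tendsto_natCast_atTop_atTop (R := ℝ) |>.comp (tendsto_scaledCount_atTop hα hL hP)
  filter_upwards [eventually_gt_atTop 0,
    hdouble.eventually (eventually_le_scaledCount_two_mul hL hP hc2),
    hU.eventually (eventually_ge_atTop (4 / ε / ((c - 1) / 2))),
    eventually_scaledCount_pos hL hP] with n hn hgrow hbig hpos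
  have hn' : (0 : ℝ) < n := by exact_mod_cast hn
  have hpos' : (0 : ℝ) < scaledCount P n := by exact_mod_cast hpos
  have hmono : (scaledCount P n : ℝ) ≤ scaledCount P (2 * n) := by
    exact_mod_cast scaledCount_mono P hn (by omega)
  obtain ⟨A, hA, hmean⟩ := exists_finset_meanUnseen_ge P hn
  have hm : (c - 1) / 2 * scaledCount P n ≤ meanUnseen P n A := by
    have := mul_le_mul_of_nonneg_left hmono hc0.le
    linarith
  have hm0 : 0 < meanUnseen P n A := lt_of_lt_of_le (by positivity) hm
  refine le_trans (measure_mono fun x hx => ?_) ((measure_unseen_le P n A hm0).trans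
    (ENNReal.ofReal_le_ofReal ?_))
  · have hx' : missingMass r P x < (1 / 4) ^ r * ((c - 1) / 4) * scaledCount P n / (n : ℝ) ^ r :=
      hx
    show ∑ s ∈ A, freqIndicator s 0 x ≤ meanUnseen P n A / 2
    by_contra! hlt
    refine absurd hx' (not_lt.2 (le_trans ?_
      (sum_unseen_le_missingMass P hr A (by positivity) hA x)))
    calc (1 / 4) ^ r * ((c - 1) / 4) * scaledCount P n / (n : ℝ) ^ r
        = (1 / (4 * n)) ^ r * ((c - 1) / 4 * scaledCount P n) := by
          rw [one_div_pow, one_div_pow, mul_pow]; field_simp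
      _ ≤ _ := mul_le_mul_of_nonneg_left (by linarith) (by positivity)
  · have hbig' : 4 / ε / ((c - 1) / 2) ≤ scaledCount P n := hbig
    rw [div_le_iff₀ (by positivity), div_le_iff₀ hε] at hbig'
    rw [div_le_iff₀ hm0]
    nlinarith

/-! ### Combination of the two bounds. -/

theorem proposition3 {S : Type*} [MeasurableSpace S] [MeasurableSingletonClass S]
    (P : PMF S) (α : ℝ) (hα : α ∈ Set.Ioo (0 : ℝ) 1)
    (L : ℝ → ℝ) (hL : IsSlowlyVarying L) (hP : HasRegularlyVaryingTails P α L)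
    (r : ℕ) (hr : 1 ≤ r) (h : ℝ → ℝ) (hh : Measurable h) :
    IsBoundedInProbability
      (fun n : ℕ => Measure.pi (fun _ : Fin n => P.toMeasure))
      (fun (n : ℕ) (x : Fin n → S) =>
        Real.sqrt ((n : ℝ) ^ α * L (n : ℝ)) *
          relativeLoss h (goodTuring r x) (missingMass r P x)) := by
  intro ε hε
  obtain ⟨d, hd, hlow⟩ := exists_measure_missingMass_lt_le hα.1 hL hP hr
  obtain ⟨C, hC, hup⟩ := exists_cappedMass_le_scaledCount hα.2 hL hP
  have hE := errorConst_pos r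
  have hequiv : ∀ᶠ n : ℕ in atTop, (n : ℝ) ^ α * L n ≤ 2 * scaledCount P n := by
    have h1 := (scaledCount_isEquivalent hP).symm.isLittleO.bound (c := 1) one_pos
    filter_upwards [h1] with n hn
    simp only [Pi.sub_apply, Real.norm_eq_abs, one_mul, Nat.abs_cast] at hn
    linarith [le_abs_self ((n : ℝ) ^ α * L n - scaledCount P n)]
  -- Chosen so that Markov's inequality at the threshold `δ` below yields `ε / 2`.
  let K : ℝ := Real.sqrt (4 * errorConst r * C / (d ^ 2 * ε))
  have hK0 : 0 < 4 * errorConst r * C / (d ^ 2 * ε) := by positivity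
  have hK : K ^ 2 = 4 * errorConst r * C / (d ^ 2 * ε) := Real.sq_sqrt hK0.le
  have hKpos : 0 < K := Real.sqrt_pos.2 hK0
  refine ⟨K, ?_⟩
  filter_upwards [hlow (ε / 2) (by positivity), hup, hequiv, eventually_ge_atTop (4 * r),
    eventually_scaledCount_pos hL hP, tendsto_natCast_atTop_atTop.eventually hL.eventually_pos]
    with n hlow hup hequiv hnr hpos hLpos
  have hn0 : 0 < n := by omega
  have hn' : (0 : ℝ) < n := by exact_mod_cast hn0
  have hpos' : (0 : ℝ) < scaledCount P n := by exact_mod_cast hpos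
  set U : ℝ := (scaledCount P n : ℝ)
  set a : ℝ := (n : ℝ) ^ α * L n
  have ha : 0 < a := mul_pos (Real.rpow_pos_of_pos hn' α) hLpos
  -- If `θ ≥ d * U / n ^ r` and `a ≤ 2 * U`, a scaled loss above `K` forces `(g - θ) ^ 2 ≥ K ^ 2 /
  -- (2 * U) * (d * U / n ^ r) ^ 2`, which is `δ`.
  let δ : ℝ := K ^ 2 * d ^ 2 * U / (2 * (n : ℝ) ^ (2 * r))
  have hδ : 0 < δ := by positivity
  have herr := measure_le_sq_goodTuring_sub_missingMass_le P hr hnr hδ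
  have hbound : errorConst r * (cappedMass P n / (n : ℝ) ^ (2 * r)) / δ ≤ ε / 2 := by
    rw [div_le_iff₀ hδ]
    calc errorConst r * (cappedMass P n / (n : ℝ) ^ (2 * r))
        ≤ errorConst r * (C * U / (n : ℝ) ^ (2 * r)) := by gcongr
      _ = ε / 2 * δ := by
          simp only [δ, hK]
          field_simp
          ring
  -- Off the first event `θ > 0`, so the loss there is the true relative error whatever `h` is.
  have hsub : {x : Fin n → S | K < |Real.sqrt a *
        relativeLoss h (goodTuring r x) (missingMass r P x)|} ⊆
      {x | missingMass r P x < d * U / (n : ℝ) ^ r} ∪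
        {x | δ ≤ (goodTuring r x - missingMass r P x) ^ 2} := by
    intro x hx
    by_cases hθ : missingMass r P x < d * U / (n : ℝ) ^ r
    · exact Or.inl hθ
    · refine Or.inr ?_
      have hx' : K < |Real.sqrt a *
        relativeLoss h (goodTuring r x) (missingMass r P x)| := hx
      rw [not_lt] at hθ
      have hb : 0 < d * U / (n : ℝ) ^ r := by positivity
      show δ ≤ (goodTuring r x - missingMass r P x) ^ 2
      generalize missingMass r P x = θ at *
      generalize goodTuring r x = g at *
      have hθ0 : 0 < θ := hb.trans_le hθ
      rw [relativeLoss, if_pos hθ0, abs_mul, abs_abs, abs_of_nonneg (Real.sqrt_nonneg a)] at hx'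
      have hsq : K ^ 2 ≤ a * (g / θ - 1) ^ 2 := by
        have := pow_le_pow_left₀ hKpos.le hx'.le 2
        rwa [mul_pow, Real.sq_sqrt ha.le, sq_abs] at this
      have hg : (g - θ) ^ 2 = (g / θ - 1) ^ 2 * θ ^ 2 := by field_simp
      have hθsq : (d * U / (n : ℝ) ^ r) ^ 2 ≤ θ ^ 2 := pow_le_pow_left₀ hb.le hθ 2
      have hK2 : K ^ 2 / (2 * U) ≤ (g / θ - 1) ^ 2 := by
        rw [div_le_iff₀ (by positivity)]
        have := mul_le_mul_of_nonneg_right hequiv (sq_nonneg (g / θ - 1))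
        linarith
      rw [hg]
      calc δ = K ^ 2 / (2 * U) * (d * U / (n : ℝ) ^ r) ^ 2 := by
            simp only [δ]
            rw [mul_comm 2 r, pow_mul]
            field_simp
        _ ≤ _ := mul_le_mul hK2 hθsq (by positivity) (by positivity)
  calc _ ≤ _ := measure_mono hsub
    _ ≤ _ := measure_union_le _ _
    _ ≤ ENNReal.ofReal (ε / 2) + ENNReal.ofReal (ε / 2) :=
        add_le_add hlow (herr.trans (ENNReal.ofReal_le_ofReal hbound))
    _ = ENNReal.ofReal ε := by
        rw [← ENNReal.ofReal_add (by positivity) (by positivity), add_halves]
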